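/- Let $I$ be a set and let $\mathcal A$ be a hypergraph on $I$, that is, a set of finite subsets of $I$, regarded as a poset category with an arrow $\alpha\to\beta$ if and only if $\beta\subseteq\alpha$. Let $X_{\mathcal A}$ be the set $\mathcal A$ with the lower Alexandrov topology, which has the basis $U_\alpha=\{\beta\in\mathcal A:\alpha\to\beta\}$, $\alpha\in\mathcal A$. A covariant functor $G$ from $\mathcal A$ to vector spaces is identified with the sheaf on $X_{\mathcal A}$ given by $G(U)=\varprojlim_{\alpha\in U}G_\alpha$. Assume that - $\mathcal A$ has the weak intersection property: if $\alpha,\alpha'\in\mathcal A$ and $\alpha\cap\alpha'\neq\emptyset$, then $\alpha\cap\alpha'\in\mathcal A$; - $\mathcal A$ is upper finitely covered: there is a finite subset $\mathcal A_{0}\subseteq\mathcal A$ such that every $\beta\in\mathcal A$ has an arrow $\beta\to\alpha$ to some $\alpha\in\mathcal A_{0}$. Let $\mathbb K$ be a field and let $E$ be a covariant functor from $\mathcal A$ to sets of product type: there are non-empty sets $E_i$ ($i\in I$) and identifications $E_\alpha\cong\prod_{i\in\alpha}E_i$ under which the maps $E_\alpha\to E_\beta$, $\beta\subseteq\alpha$,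 are the projections. Let $F$ be the free sheaf generated by $E$, $F_\alpha=\mathbb K^{(E_\alpha)}$ (functions with finite support), let $\overline F\subseteq F$ be the restricted free sheaf, $\overline F_\alpha=\{f\in F_\alpha:\sum_{e\in E_\alpha} f(e)=0\}$, and let $\mathbb K$ also denote the constant sheaf on $X_{\mathcal A}$. Write $H^n(X_{\mathcal A};-)$ for Čech cohomology, the direct limit of the cohomology of open coverings under refinement. Then: 1. $H^n(X_{\mathcal A};\overline F)=0$ for all $n\ge 1$. 2. There are coherent families of points $x=(x_\alpha)\in\varprojlim_{\alpha\in\mathcal A} E_\alpha$, and for each of them and each $n\ge 0$ the map $$H^n(X_{\mathcal A};\overline F)\oplus H^n(X_{\mathcal A};\mathbb K)\longrightarrow H^n(X_{\mathcal A};F)$$ induced by the inclusion $\overline F\to F$ and by the morphism $\mathbb K\to F$, $r\mapsto r\,x_\alpha$, is an isomorphism; composed with the map $H^n(X_{\mathcal A};F)\to H^n(X_{\mathcal A};\mathbb K)$ induced by the sum of coordinates, it is the projection to the second summand. 3. These isomorphisms are natural: a natural transformation $E\to E'$ of functors of product type that takes the family $x$ to $x'$ commutes with the isomorphisms given by $(E,x)$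 and $(E',x')$. -/

import Mathlib

open CategoryTheory TopologicalSpace Opposite

universe u

noncomputable section

namespace CechHypergraph

/-! ### Cohomology of a cochain complex of vector spaces -/

section Complex

variable {K : Type u} [Field K]
variable {C C' : ℕ → Type u}
variable [∀ n, AddCommGroup (C n)] [∀ n, Module K (C n)]
variable [∀ n, AddCommGroup (C' n)] [∀ n, Module K (C' n)]

/-- The `n`-coboundaries: the image of the differential coming from degree `n - 1`
(zero for `n = 0`). -/
def coboundaries (d : ∀ n, C n →ₗ[K] C (n + 1)) : ∀ n, Submodule K (C n)
  | 0 => ⊥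
  | n + 1 => LinearMap.range (d n)

/-- `Hⁿ = ker dₙ / im dₙ₋₁`. -/
abbrev Cohomology (d : ∀ n, C n →ₗ[K] C (n + 1)) (n : ℕ) : Type u :=
  ↥(LinearMap.ker (d n)) ⧸ (coboundaries d n).comap (LinearMap.ker (d n)).subtype

theorem cochainMap_mem_ker (d : ∀ n, C n →ₗ[K] C (n + 1)) (d' : ∀ n, C' n →ₗ[K] C' (n + 1))
    (φ : ∀ n, C n →ₗ[K] C' n) (hφ : ∀ n c, d' n (φ n c) = φ (n + 1) (d n c)) (n : ℕ)
    (c : C n) (hc : c ∈ LinearMap.ker (d n)) : φ n c ∈ LinearMap.ker (d' n) := by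
  rw [LinearMap.mem_ker] at hc ⊢
  rw [hφ, hc, map_zero]

theorem cochainMap_mem_coboundaries (d : ∀ n, C n →ₗ[K] C (n + 1))
    (d' : ∀ n, C' n →ₗ[K] C' (n + 1))
    (φ : ∀ n, C n →ₗ[K] C' n) (hφ : ∀ n c, d' n (φ n c) = φ (n + 1) (d n c)) (n : ℕ)
    (c : C n) (hc : c ∈ coboundaries d n) : φ n c ∈ coboundaries d' n := by
  cases n with
  | zero =>
    have h0 : c = 0 := hc
    rw [h0, map_zero]
    exact Submodule.zero_mem _
  | succ n =>
    obtain ⟨b, rfl⟩ := hc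
    exact ⟨φ n b, hφ n b⟩

/-- The map induced in cohomology by a cochain map. -/
def cohomologyMap (d : ∀ n, C n →ₗ[K] C (n + 1)) (d' : ∀ n, C' n →ₗ[K] C' (n + 1))
    (φ : ∀ n, C n →ₗ[K] C' n) (hφ : ∀ n c, d' n (φ n c) = φ (n + 1) (d n c)) (n : ℕ) :
    Cohomology d n →ₗ[K] Cohomology d' n :=
  Submodule.mapQ _ _
    ((φ n).restrict (cochainMap_mem_ker d d' φ hφ n))
    (fun c hc => cochainMap_mem_coboundaries d d' φ hφ n c.1 hc)

end Complex

/-! ### Čech cohomology of a presheaf of vector spaces -/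

section Cech

/-- An open covering of `X`: a set of open subsets whose union is `X`. -/
structure OpenCover (X : Type u) [TopologicalSpace X] : Type u where
  sets : Set (Opens X)
  covers : ∀ x : X, ∃ U ∈ sets, x ∈ U

variable {X : Type u} [TopologicalSpace X]

/-- `𝒰 ≤ 𝒱` when `𝒱` refines `𝒰`. -/
instance : Preorder (OpenCover X) where
  le 𝒰 𝒱 := ∀ V ∈ 𝒱.sets, ∃ U ∈ 𝒰.sets, V ≤ U
  le_refl _ := fun V hV => ⟨V, hV, le_rfl⟩
  le_trans _ _ _ h₁ h₂ := fun W hW => by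
    obtain ⟨V, hV, hWV⟩ := h₂ W hW
    obtain ⟨U, hU, hVU⟩ := h₁ V hV
    exact ⟨U, hU, hWV.trans hVU⟩

instance : DecidableEq (OpenCover X) := Classical.decEq _

/-- The `n`-simplices of the nerve of a covering: sequences `(U₀, …, Uₙ)` of members of the
covering with non-empty intersection. -/
def Nerve (𝒰 : OpenCover X) (n : ℕ) : Type u :=
  {v : Fin (n + 1) → ↥𝒰.sets // ∃ x : X, ∀ i, x ∈ (v i : Opens X)}

namespace Nerve

/-- The intersection `U₀ ∩ … ∩ Uₙ`. -/
def inter {𝒰 : OpenCover X} {n : ℕ} (v : Nerve 𝒰 n) : Opens X :=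
  ⨅ i, (v.1 i : Opens X)

/-- The `i`-th face: omit `Uᵢ`. -/
def face {𝒰 : OpenCover X} {n : ℕ} (v : Nerve 𝒰 (n + 1)) (i : Fin (n + 2)) : Nerve 𝒰 n :=
  ⟨fun j => v.1 (i.succAbove j), by
    obtain ⟨x, hx⟩ := v.2
    exact ⟨x, fun j => hx _⟩⟩

theorem inter_le_face {𝒰 : OpenCover X} {n : ℕ} (v : Nerve 𝒰 (n + 1)) (i : Fin (n + 2)) :
    v.inter ≤ (v.face i).inter :=
  le_iInf fun j => iInf_le (fun k => (v.1 k : Opens X)) (i.succAbove j)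

end Nerve

/-- A projection `λ : 𝒱 → 𝒰` with `V ⊆ λ V` for a refinement `𝒱` of `𝒰`. The map it induces in
cohomology does not depend on the choice. -/
def projection {𝒰 𝒱 : OpenCover X} (h : 𝒰 ≤ 𝒱) (V : ↥𝒱.sets) : ↥𝒰.sets :=
  ⟨(h V.1 V.2).choose, (h V.1 V.2).choose_spec.1⟩

theorem le_projection {𝒰 𝒱 : OpenCover X} (h : 𝒰 ≤ 𝒱) (V : ↥𝒱.sets) :
    (V : Opens X) ≤ projection h V :=
  (h V.1 V.2).choose_spec.2

/-- The map of nerves induced by a projection. -/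
def Nerve.proj {𝒰 𝒱 : OpenCover X} (h : 𝒰 ≤ 𝒱) {n : ℕ} (v : Nerve 𝒱 n) : Nerve 𝒰 n :=
  ⟨fun i => projection h (v.1 i), by
    obtain ⟨x, hx⟩ := v.2
    exact ⟨x, fun i => le_projection h _ (hx i)⟩⟩

theorem Nerve.inter_le_proj {𝒰 𝒱 : OpenCover X} (h : 𝒰 ≤ 𝒱) {n : ℕ} (v : Nerve 𝒱 n) :
    v.inter ≤ (v.proj h).inter :=
  le_iInf fun i => (iInf_le (fun k => (v.1 k : Opens X)) i).trans (le_projection h (v.1 i))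

variable {K : Type u} [Field K]

/-- The restriction `F(V) → F(U)` for `U ⊆ V`. -/
def res (F : (Opens X)ᵒᵖ ⥤ ModuleCat.{u} K) {U V : Opens X} (h : U ≤ V) :
    F.obj (op V) →ₗ[K] F.obj (op U) :=
  (F.map (homOfLE h).op).hom

theorem res_res (F : (Opens X)ᵒᵖ ⥤ ModuleCat.{u} K) {U V W : Opens X} (h : U ≤ V) (h' : V ≤ W)
    (s : F.obj (op W)) : res F h (res F h' s) = res F (h.trans h') s := by
  have e : (homOfLE (h.trans h')).op = (homOfLE h').op ≫ (homOfLE h).op := rfl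
  simp only [res, e, F.map_comp, ModuleCat.hom_comp, LinearMap.comp_apply]

theorem res_naturality {F G : (Opens X)ᵒᵖ ⥤ ModuleCat.{u} K} (φ : F ⟶ G) {U V : Opens X}
    (h : U ≤ V) (s : F.obj (op V)) :
    res G h ((φ.app (op V)).hom s) = (φ.app (op U)).hom (res F h s) := by
  have e := congrArg (fun f => f.hom s) (φ.naturality (homOfLE h).op)
  exact e.symm

/-- The Čech `n`-cochains `∏ F(U₀ ∩ … ∩ Uₙ)`, over the `n`-simplices of the nerve. -/
abbrev Cochain (F : (Opens X)ᵒᵖ ⥤ ModuleCat.{u} K) (𝒰 : OpenCover X) (n : ℕ) : Type u :=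
  ∀ v : Nerve 𝒰 n, F.obj (op v.inter)

/-- The Čech differential
`(δ c)(U₀, …, Uₙ₊₁) = ∑ᵢ (-1)ⁱ c(U₀, …, Ûᵢ, …, Uₙ₊₁)|_{U₀ ∩ … ∩ Uₙ₊₁}`. -/
def delta (F : (Opens X)ᵒᵖ ⥤ ModuleCat.{u} K) (𝒰 : OpenCover X) (n : ℕ) :
    Cochain F 𝒰 n →ₗ[K] Cochain F 𝒰 (n + 1) :=
  LinearMap.pi fun v =>
    ∑ i : Fin (n + 2), (-1 : K) ^ (i : ℕ) •
      (res F (v.inter_le_face i) ∘ₗ LinearMap.proj (v.face i))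

theorem delta_apply (F : (Opens X)ᵒᵖ ⥤ ModuleCat.{u} K) (𝒰 : OpenCover X) (n : ℕ)
    (c : Cochain F 𝒰 n) (v : Nerve 𝒰 (n + 1)) :
    delta F 𝒰 n c v =
      ∑ i : Fin (n + 2), (-1 : K) ^ (i : ℕ) • res F (v.inter_le_face i) (c (v.face i)) := by
  simp [delta, LinearMap.sum_apply]

/-- The cohomology `Hⁿ(𝒰; F)` of an open covering. -/
abbrev CoverCohomology (F : (Opens X)ᵒᵖ ⥤ ModuleCat.{u} K) (n : ℕ) (𝒰 : OpenCover X) : Type u :=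
  Cohomology (delta F 𝒰) n

/-- The cochain map of a refinement:
`(λ* c)(V₀, …, Vₙ) = c(λ V₀, …, λ Vₙ)|_{V₀ ∩ … ∩ Vₙ}`. -/
def refineCochain (F : (Opens X)ᵒᵖ ⥤ ModuleCat.{u} K) {𝒰 𝒱 : OpenCover X} (h : 𝒰 ≤ 𝒱) (n : ℕ) :
    Cochain F 𝒰 n →ₗ[K] Cochain F 𝒱 n :=
  LinearMap.pi fun v => res F (v.inter_le_proj h) ∘ₗ LinearMap.proj (v.proj h)

theorem delta_refineCochain (F : (Opens X)ᵒᵖ ⥤ ModuleCat.{u} K) {𝒰 𝒱 : OpenCover X} (h : 𝒰 ≤ 𝒱)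
    (n : ℕ) (c : Cochain F 𝒰 n) :
    delta F 𝒱 n (refineCochain F h n c) = refineCochain F h (n + 1) (delta F 𝒰 n c) := by
  funext v
  have e : refineCochain F h (n + 1) (delta F 𝒰 n c) v =
      res F (v.inter_le_proj h) (delta F 𝒰 n c (v.proj h)) := rfl
  rw [e, delta_apply, delta_apply, map_sum]
  refine Finset.sum_congr rfl fun i _ => ?_
  rw [map_smul, res_res]
  have e' : refineCochain F h n c (v.face i) =
      res F ((v.face i).inter_le_proj h) (c ((v.face i).proj h)) := rfl
  rw [e', res_res]
  rfl

/-- The map `Hⁿ(𝒰; F) → Hⁿ(𝒱; F)` of a refinement `𝒱` of `𝒰`. -/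
def refine (F : (Opens X)ᵒᵖ ⥤ ModuleCat.{u} K) (n : ℕ) (𝒰 𝒱 : OpenCover X) (h : 𝒰 ≤ 𝒱) :
    CoverCohomology F n 𝒰 →ₗ[K] CoverCohomology F n 𝒱 :=
  cohomologyMap _ _ (refineCochain F h) (delta_refineCochain F h) n

/-- The Čech cohomology `Hⁿ(X; F)`: the direct limit of the `Hⁿ(𝒰; F)` over all open coverings,
directed by refinement. -/
abbrev CechCohomology (F : (Opens X)ᵒᵖ ⥤ ModuleCat.{u} K) (n : ℕ) : Type u :=
  Module.DirectLimit (CoverCohomology F n) (refine F n)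

/-- The cochain map induced by a morphism of presheaves. -/
def coeffCochain {F G : (Opens X)ᵒᵖ ⥤ ModuleCat.{u} K} (φ : F ⟶ G) (𝒰 : OpenCover X) (n : ℕ) :
    Cochain F 𝒰 n →ₗ[K] Cochain G 𝒰 n :=
  LinearMap.pi fun v => (φ.app (op v.inter)).hom ∘ₗ LinearMap.proj v

theorem delta_coeffCochain {F G : (Opens X)ᵒᵖ ⥤ ModuleCat.{u} K} (φ : F ⟶ G) (𝒰 : OpenCover X)
    (n : ℕ) (c : Cochain F 𝒰 n) :
    delta G 𝒰 n (coeffCochain φ 𝒰 n c) = coeffCochain φ 𝒰 (n + 1) (delta F 𝒰 n c) := by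
  funext v
  have e : coeffCochain φ 𝒰 (n + 1) (delta F 𝒰 n c) v =
      (φ.app (op v.inter)).hom (delta F 𝒰 n c v) := rfl
  rw [e, delta_apply, delta_apply, map_sum]
  refine Finset.sum_congr rfl fun i _ => ?_
  rw [map_smul, ← res_naturality]
  rfl

/-- The map `Hⁿ(𝒰; F) → Hⁿ(𝒰; G)` induced by a morphism of presheaves. -/
def coverMap {F G : (Opens X)ᵒᵖ ⥤ ModuleCat.{u} K} (φ : F ⟶ G) (n : ℕ) (𝒰 : OpenCover X) :
    CoverCohomology F n 𝒰 →ₗ[K] CoverCohomology G n 𝒰 :=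
  cohomologyMap _ _ (coeffCochain φ 𝒰) (delta_coeffCochain φ 𝒰) n

theorem coverMap_refine {F G : (Opens X)ᵒᵖ ⥤ ModuleCat.{u} K} (φ : F ⟶ G) (n : ℕ)
    (𝒰 𝒱 : OpenCover X) (h : 𝒰 ≤ 𝒱) :
    coverMap φ n 𝒱 ∘ₗ refine F n 𝒰 𝒱 h = refine G n 𝒰 𝒱 h ∘ₗ coverMap φ n 𝒰 := by
  refine Submodule.linearMap_qext _ (LinearMap.ext fun c => ?_)
  refine congrArg (Submodule.Quotient.mk) (Subtype.ext (funext fun v => ?_))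
  exact (res_naturality φ (v.inter_le_proj h) (c.1 (v.proj h))).symm

/-- The map `Hⁿ(X; F) → Hⁿ(X; G)` induced by a morphism of presheaves. -/
def cechMap {F G : (Opens X)ᵒᵖ ⥤ ModuleCat.{u} K} (φ : F ⟶ G) (n : ℕ) :
    CechCohomology F n →ₗ[K] CechCohomology G n :=
  Module.DirectLimit.map (coverMap φ n) (coverMap_refine φ n)

end Cech

/-! ### Sheaves on a poset with the lower Alexandrov topology

The category of a poset `P` has an arrow `α ⟶ β` if and only if `α ≤ β`. The topology has the
basis `U_α = {β | α ⟶ β}`; its open sets are the upper sets of `≤`, which is the topology of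
`Topology.WithUpperSet P`. -/

section Alexandrov

variable {K : Type u} [Field K] {P : Type u} [Preorder P]

/-- The sections over `U` of the sheaf that extends a covariant functor `G` on `P`: coherent
families `(s_α)`, `α ∈ U`. -/
def sectionsOver (G : P ⥤ ModuleCat.{u} K) (U : Opens (Topology.WithUpperSet P)) :
    Submodule K (∀ α : {α : P // Topology.WithUpperSet.toUpperSet α ∈ U}, G.obj α.1) where
  carrier := {s | ∀ (α β : {α : P // Topology.WithUpperSet.toUpperSet α ∈ U}) (f : α.1 ⟶ β.1),
    (G.map f).hom (s α) = s β}
  zero_mem' := fun _ _ _ => map_zero _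
  add_mem' := fun {s t} hs ht α β f => by
    rw [Pi.add_apply, map_add, hs α β f, ht α β f, Pi.add_apply]
  smul_mem' := fun r s hs α β f => by
    rw [Pi.smul_apply, map_smul, hs α β f, Pi.smul_apply]

/-- The sheaf on the lower Alexandrov space of `P` that extends a covariant functor on `P`;
restrictions are the restrictions of families. -/
def toSheaf (G : P ⥤ ModuleCat.{u} K) :
    (Opens (Topology.WithUpperSet P))ᵒᵖ ⥤ ModuleCat.{u} K where
  obj U := ModuleCat.of K (sectionsOver G U.unop)
  map {_ V} i := ModuleCat.ofHom
    { toFun := fun s => (⟨fun α => s.1 ⟨α.1, i.unop.le α.2⟩, fun α β f =>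
        s.2 ⟨α.1, i.unop.le α.2⟩ ⟨β.1, i.unop.le β.2⟩ f⟩ : sectionsOver G V.unop)
      map_add' := fun _ _ => rfl
      map_smul' := fun _ _ => rfl }
  map_id _ := rfl
  map_comp _ _ := rfl

/-- The morphism of sheaves induced by a natural transformation. -/
def toSheafMap {G G' : P ⥤ ModuleCat.{u} K} (φ : G ⟶ G') : toSheaf G ⟶ toSheaf G' where
  app U := ModuleCat.ofHom (X := sectionsOver G U.unop) (Y := sectionsOver G' U.unop)
    { toFun := fun s => ⟨fun α => (φ.app α.1).hom (s.1 α), fun α β f => by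
        have e := congrArg (fun g => g.hom (s.1 α)) (φ.naturality f)
        exact e.symm.trans (congrArg (φ.app β.1).hom (s.2 α β f))⟩
      map_add' := fun _ _ => Subtype.ext (funext fun _ => map_add _ _ _)
      map_smul' := fun _ _ => Subtype.ext (funext fun _ => map_smul _ _ _) }
  naturality _ _ _ := rfl

end Alexandrov

/-! ### Hypergraphs and free sheaves -/

section Hypergraph

/-- The poset of a hypergraph `A` (a set of finite subsets of `I`), ordered by reverse
inclusion: there is an arrow `α ⟶ β` if and only if `β ⊆ α`. -/
abbrev HPoset {I : Type u} (A : Set (Finset I)) : Type u := (↥A)ᵒᵈ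

/-- The finite subset of `I` underlying an object of the poset. -/
def verts {I : Type u} {A : Set (Finset I)} (α : HPoset A) : Finset I := (OrderDual.ofDual α).1

theorem verts_subset {I : Type u} {A : Set (Finset I)} {α β : HPoset A} (f : α ⟶ β) :
    verts β ⊆ verts α := leOfHom f

/-- The weak intersection property. -/
def WeakIntersection {I : Type u} [DecidableEq I] (A : Set (Finset I)) : Prop :=
  ∀ α ∈ A, ∀ β ∈ A, (α ∩ β).Nonempty → α ∩ β ∈ A

/-- A poset is upper finitely covered if there are finitely many objects such that every object
has an arrow to one of them. -/
def UpperFinitelyCovered (P : Type u) [Preorder P] : Prop :=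
  ∃ S : Set P, S.Finite ∧ ∀ β : P, ∃ α ∈ S, β ≤ α

/-- `E` is (isomorphic to) the functor `α ↦ ∏_{i ∈ α} Eᵢ`, with the projections as transition maps,
for a family of non-empty sets `Eᵢ`. -/
def IsProductFunctor {I : Type u} {A : Set (Finset I)} (E : HPoset A ⥤ Type u) : Prop :=
  ∃ (B : I → Type u) (_ : ∀ i, Nonempty (B i))
    (e : ∀ α : HPoset A, E.obj α ≃ (∀ i : {i : I // i ∈ verts α}, B i.1)),
    ∀ (α β : HPoset A) (f : α ⟶ β) (x : E.obj α) (i : {i : I // i ∈ verts β}),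
      e β (E.map f x) i = e α x ⟨i.1, verts_subset f i.2⟩

variable {P : Type u} [Preorder P]
variable (K : Type u) [Field K]

/-- The sum of the coordinates in the canonical basis. -/
def sumCoord (S : Type u) : (S →₀ K) →ₗ[K] K :=
  Finsupp.linearCombination K fun _ => (1 : K)

theorem sumCoord_mapDomain {S T : Type u} (f : S → T) (w : S →₀ K) :
    sumCoord K T (Finsupp.lmapDomain K K f w) = sumCoord K S w := by
  simp only [sumCoord, Finsupp.lmapDomain_apply]
  rw [Finsupp.linearCombination_mapDomain]
  rfl

/-- The free copresheaf `F_α = K^(E_α)` of finitely supported functions. -/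
def freeFunctor (E : P ⥤ Type u) : P ⥤ ModuleCat.{u} K := E ⋙ ModuleCat.free K

/-- The restricted free copresheaf `F̄_α`: the elements of `F_α` whose sum of coordinates
is zero. -/
def restrictedFunctor (E : P ⥤ Type u) : P ⥤ ModuleCat.{u} K where
  obj α := ModuleCat.of K (LinearMap.ker (sumCoord K (E.obj α)))
  map {α β} f := ModuleCat.ofHom
    ((Finsupp.lmapDomain K K (E.map f)).restrict fun w hw => by
      rw [LinearMap.mem_ker] at hw ⊢
      rw [sumCoord_mapDomain, hw])
  map_id α := by
    ext1
    refine LinearMap.ext fun w => Subtype.ext ?_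
    exact congrArg (fun g => g.hom w.1) ((freeFunctor K E).map_id α)
  map_comp f g := by
    ext1
    refine LinearMap.ext fun w => Subtype.ext ?_
    exact congrArg (fun h => h.hom w.1) ((freeFunctor K E).map_comp f g)

/-- The constant functor with value `K`. -/
def constFunctor (P : Type u) [Preorder P] : P ⥤ ModuleCat.{u} K :=
  (Functor.const P).obj (ModuleCat.of K K)

/-- The inclusion `F̄ ⟶ F`. -/
def inclusion (E : P ⥤ Type u) : restrictedFunctor K E ⟶ freeFunctor K E where
  app α := ModuleCat.ofHom (LinearMap.ker (sumCoord K (E.obj α))).subtype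
  naturality _ _ _ := rfl

/-- The sum of coordinates `F ⟶ K`. -/
def augmentation (E : P ⥤ Type u) : freeFunctor K E ⟶ constFunctor K P where
  app α := ModuleCat.ofHom (sumCoord K (E.obj α))
  naturality α β f := by
    ext1
    exact LinearMap.ext fun w => sumCoord_mapDomain K (E.map f) w

/-- The embedding of constants `K ⟶ F`, `r ↦ r · x_α`, given by a coherent family of points
`x_α ∈ E_α`. It is a section of the sum of coordinates. -/
def constEmbedding (E : P ⥤ Type u) (x : E.sections) : constFunctor K P ⟶ freeFunctor K E where
  app α := ModuleCat.ofHom (Finsupp.lsingle (x.1 α))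
  naturality α β f := by
    ext1
    refine LinearMap.ext fun r => ?_
    have e : E.map f (x.1 α) = x.1 β := x.2 f
    change Finsupp.single (x.1 β) r = Finsupp.mapDomain (E.map f) (Finsupp.single (x.1 α) r)
    rw [Finsupp.mapDomain_single, e]

/-- Functoriality of the free copresheaf in `E`. -/
def freeMap {E E' : P ⥤ Type u} (φ : E ⟶ E') : freeFunctor K E ⟶ freeFunctor K E' :=
  Functor.whiskerRight φ (ModuleCat.free K)

/-- Functoriality of the restricted free copresheaf in `E`. -/
def restrictedMap {E E' : P ⥤ Type u} (φ : E ⟶ E') :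
    restrictedFunctor K E ⟶ restrictedFunctor K E' where
  app α := ModuleCat.ofHom
    ((Finsupp.lmapDomain K K (φ.app α)).restrict fun w hw => by
      rw [LinearMap.mem_ker] at hw ⊢
      rw [sumCoord_mapDomain, hw])
  naturality α β f := by
    ext1
    refine LinearMap.ext fun w => Subtype.ext ?_
    have e := congrArg (fun g => g.hom w.1) ((freeMap K φ).naturality f)
    exact e

/-- `Hⁿ(X_P; F)`, with `F` the free sheaf generated by `E`. -/
abbrev HFree (E : P ⥤ Type u) (n : ℕ) : Type u :=
  CechCohomology (toSheaf (freeFunctor K E)) n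

/-- `Hⁿ(X_P; F̄)`, with `F̄` the restricted free sheaf generated by `E`. -/
abbrev HRestricted (E : P ⥤ Type u) (n : ℕ) : Type u :=
  CechCohomology (toSheaf (restrictedFunctor K E)) n

/-- `Hⁿ(X_P; K)`, the Čech cohomology with coefficients in the constant sheaf `K`. -/
abbrev HConst (P : Type u) [Preorder P] (n : ℕ) : Type u :=
  CechCohomology (toSheaf (constFunctor K P)) n

/-- The map `Hⁿ(X_P; F̄) ⊕ Hⁿ(X_P; K) → Hⁿ(X_P; F)` induced by the two morphisms of sheaves
`F̄ ⟶ F` (the inclusion) and `K ⟶ F` (given by a coherent family of points of `E`). -/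
def decomposition (E : P ⥤ Type u) (x : E.sections) (n : ℕ) :
    (HRestricted K E n × HConst K P n) →ₗ[K] HFree K E n :=
  (cechMap (toSheafMap (inclusion K E)) n).coprod
    (cechMap (toSheafMap (constEmbedding K E x)) n)

end Hypergraph

end CechHypergraph

end

/-! The decomposition is formal. A coherent family `x` splits `F ⟶ K`, so `F` is the direct sum of
`F̄` and `K` already as copresheaves, and Čech cohomology is additive and functorial in the
coefficients. Restricting one point of the full product gives such a family.

The substance is the vanishing for `F̄`. The covering by all `U_α` refines every covering, so it
suffices to find primitives of cocycles there (`cechCohomology_subsingleton`). A member of the nerve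
is a tuple of edges whose intersection is again an edge, and a section over the simplex is
determined by its value at that edge. A base point embeds all these values in one space `M = K^(∏
E_i)`, on which truncation of coordinates outside `δ` gives operators with `ρ_α ρ_β = ρ_(α ∩ β)`. A
cochain becomes a function `c` on tuples, fixed by `ρ` of the intersection and killed by `ρ_∅`.
Tuples outside the nerve have empty intersection, so extension by zero does no harm; this is where
sum zero matters.

Möbius inversion `ρ_α = ∑_{γ ⊆ α} π_γ` splits the complex of all tuples. The `γ`-part sees only
tuples of edges containing `γ`, which form a full simplex, and it is contracted by coning with one
such edge (`exists_tuple_primitive`). -/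

noncomputable section

namespace CechHypergraph

/-! ### Möbius inversion for a commuting family of idempotents -/

section Moebius

variable {I : Type*} [DecidableEq I] {R : Type*} [Ring R]

/-- The Möbius inverse of a family `ρ` indexed by finite sets, so that
`ρ α = ∑ γ ⊆ α, moebius ρ γ`. -/
def moebius (ρ : Finset I → R) (γ : Finset I) : R :=
  ρ γ - ∑ δ : {δ // δ ∈ γ.ssubsets}, moebius ρ δ.1
termination_by γ.card
decreasing_by exact Finset.card_lt_card (Finset.mem_ssubsets.1 δ.2)

theorem moebius_eq (ρ : Finset I → R) (γ : Finset I) :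
    moebius ρ γ = ρ γ - ∑ δ ∈ γ.ssubsets, moebius ρ δ := by
  rw [moebius, Finset.sum_coe_sort γ.ssubsets (moebius ρ)]

theorem sum_moebius (ρ : Finset I → R) (α : Finset I) :
    ∑ γ ∈ α.powerset, moebius ρ γ = ρ α := by
  rw [← Finset.insert_erase (Finset.mem_powerset_self α),
    Finset.sum_insert (Finset.notMem_erase _ _)]
  conv_lhs => rw [moebius_eq]
  exact sub_add_cancel _ _

theorem moebius_empty (ρ : Finset I → R) : moebius ρ ∅ = ρ ∅ := by
  simpa using sum_moebius ρ ∅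

/-- Multiplying by `ρ α` selects the Möbius components supported inside `α`; this is what separates
the complex into independent parts. -/
theorem mul_moebius {ρ : Finset I → R} (hρ : ∀ α β, ρ α * ρ β = ρ (α ∩ β)) (α γ : Finset I) :
    ρ α * moebius ρ γ = if γ ⊆ α then moebius ρ γ else 0 := by
  induction γ using Finset.strongInduction with
  | H γ ih =>
    have hs : ρ α * moebius ρ γ =
        ρ (α ∩ γ) - ∑ δ ∈ γ.ssubsets, if δ ⊆ α then moebius ρ δ else 0 := by
      rw [moebius_eq, mul_sub, hρ, Finset.mul_sum]
      exact congrArg _ (Finset.sum_congr rfl fun δ hδ => ih δ (Finset.mem_ssubsets.1 hδ))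
    rw [hs]
    split_ifs with h
    · rw [Finset.inter_eq_right.2 h, moebius_eq ρ γ]
      refine congrArg _ (Finset.sum_congr rfl fun δ hδ => if_pos ?_)
      exact (Finset.mem_ssubsets.1 hδ).subset.trans h
    -- As `γ` is not contained in `α`, the subsets of `α ∩ γ` are exactly the proper subsets of `γ`
    -- lying in `α`.
    · rw [← Finset.sum_filter, ← sum_moebius ρ (α ∩ γ), sub_eq_zero]
      refine Finset.sum_congr (Finset.ext fun δ => ?_) fun _ _ => rfl
      simp only [Finset.mem_powerset, Finset.mem_filter, Finset.mem_ssubsets,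
        Finset.subset_inter_iff]
      refine ⟨fun hδ => ⟨hδ.2.ssubset_of_ne ?_, hδ.1⟩, fun hδ => ⟨hδ.2, hδ.1.subset⟩⟩
      rintro rfl
      exact h hδ.1

/-- `moebius ρ γ` is a combination of the `ρ δ` with `δ ⊆ γ ⊆ α`, and each of these absorbs `ρ α`.
-/
theorem moebius_mul {ρ : Finset I → R} (hρ : ∀ α β, ρ α * ρ β = ρ (α ∩ β)) {α γ : Finset I}
    (h : γ ⊆ α) : moebius ρ γ * ρ α = moebius ρ γ := by
  induction γ using Finset.strongInduction with
  | H γ ih =>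
    rw [moebius_eq, sub_mul, hρ, Finset.sum_mul, Finset.inter_eq_left.2 h]
    refine congrArg _ (Finset.sum_congr rfl fun δ hδ => ?_)
    have := Finset.mem_ssubsets.1 hδ
    exact ih δ this (this.subset.trans h)

end Moebius

/-! ### Acyclicity of the complex of tuples -/

section Tuples

variable {I : Type*} [DecidableEq I] {T : Type*}

/-- The intersection of a tuple of finite sets. -/
def tupleInter (s : T → Finset I) {n : ℕ} (v : Fin (n + 1) → T) : Finset I :=
  Finset.univ.inf' ⟨0, Finset.mem_univ 0⟩ fun i => s (v i)

theorem subset_tupleInter {s : T → Finset I} {n : ℕ} {v : Fin (n + 1) → T} {γ : Finset I} :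
    γ ⊆ tupleInter s v ↔ ∀ i, γ ⊆ s (v i) := by
  simpa [tupleInter] using Finset.le_inf'_iff ⟨0, Finset.mem_univ 0⟩ fun i => s (v i)

theorem tupleInter_face (s : T → Finset I) {n : ℕ} (v : Fin (n + 2) → T) (i : Fin (n + 2)) :
    tupleInter s v ⊆ tupleInter s fun j => v (i.succAbove j) :=
  subset_tupleInter.2 fun _ => subset_tupleInter.1 subset_rfl _

theorem tupleInter_mem {A : Set (Finset I)}
    (hA : ∀ α ∈ A, ∀ β ∈ A, (α ∩ β).Nonempty → α ∩ β ∈ A) {s : T → Finset I} (hs : ∀ t, s t ∈ A)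
    {n : ℕ} (v : Fin (n + 1) → T) (h : (tupleInter s v).Nonempty) : tupleInter s v ∈ A := by
  revert h
  -- Nonemptiness of the total intersection passes up to the partial ones, so it can be part of the
  -- induction predicate.
  refine Finset.inf'_induction (p := fun t => t.Nonempty → t ∈ A) _ _ ?_ fun i _ _ => hs _
  intro α hα β hβ h
  exact hA α (hα (h.mono Finset.inter_subset_left)) β (hβ (h.mono Finset.inter_subset_right)) h

variable {K : Type*} [Field K] {M : Type*} [AddCommGroup M] [Module K M]

/-- The primitive is a cone construction performed separately on each Möbius component `γ`, with an
apex `σ γ` whose set contains `γ`. The apex depends on `γ` alone and not on the tuple, so the usual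
cone identity holds in every component. -/
theorem exists_tuple_primitive {ρ : Finset I → Module.End K M}
    (hρ : ∀ α β, ρ α * ρ β = ρ (α ∩ β)) (s : T → Finset I) {n : ℕ}
    (c : (Fin (n + 2) → T) → M) (hc : ∀ v, ρ (tupleInter s v) (c v) = c v)
    (hc₀ : ∀ v, ρ ∅ (c v) = 0)
    (hδ : ∀ w : Fin (n + 3) → T, ∑ i : Fin (n + 3), (-1 : K) ^ (i : ℕ) •
      ρ (tupleInter s w) (c fun j => w (i.succAbove j)) = 0) :
    ∃ b : (Fin (n + 1) → T) → M, (∀ u, ρ ∅ (b u) = 0) ∧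
      ∀ v : Fin (n + 2) → T, ∑ i : Fin (n + 2), (-1 : K) ^ (i : ℕ) •
        ρ (tupleInter s v) (b fun j => v (i.succAbove j)) = c v := by
  classical
  rcases isEmpty_or_nonempty T with hT | hT
  · exact ⟨fun _ => 0, fun _ => map_zero _, fun v => hT.elim (v 0)⟩
  have hσ : ∀ γ : Finset I, ∃ t : T, (∃ t', γ ⊆ s t') → γ ⊆ s t := fun γ => by
    by_cases h : ∃ t', γ ⊆ s t'
    · exact ⟨h.choose, fun _ => h.choose_spec⟩
    · exact ⟨hT.some, fun h' => absurd h' h⟩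
  choose σ hσ using hσ
  refine ⟨fun u => ∑ γ ∈ (tupleInter s u).powerset,
    (moebius ρ γ : Module.End K M) (c (Fin.cons (σ γ) u : Fin (n + 2) → T)), fun u => ?_, fun v => ?_⟩
  · rw [map_sum]
    refine Finset.sum_eq_zero fun γ _ => ?_
    rw [← Module.End.mul_apply, mul_moebius hρ]
    split_ifs with h
    · rw [Finset.subset_empty.1 h, moebius_empty, hc₀]
    · rfl
  -- Applying `ρ` cuts the sum for each face down to the subsets of the full intersection. The index
  -- set no longer depends on the face, so the two sums can be exchanged.
  · have hface : ∀ i : Fin (n + 2), ρ (tupleInter s v)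
        (∑ γ ∈ (tupleInter s fun j => v (i.succAbove j)).powerset,
          (moebius ρ γ : Module.End K M) (c (Fin.cons (σ γ) (fun j => v (i.succAbove j)) : Fin (n + 2) → T))) =
        ∑ γ ∈ (tupleInter s v).powerset,
          (moebius ρ γ : Module.End K M) (c (Fin.cons (σ γ) (fun j => v (i.succAbove j)) : Fin (n + 2) → T)) := fun i => by
      rw [map_sum, ← Finset.sum_subset (Finset.powerset_mono.2 (tupleInter_face s v i))]
      · refine Finset.sum_congr rfl fun γ hγ => ?_
        rw [← Module.End.mul_apply, mul_moebius hρ, if_pos (Finset.mem_powerset.1 hγ)]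
      · intro γ _ hγ
        rw [← Module.End.mul_apply, mul_moebius hρ, if_neg (mt Finset.mem_powerset.2 hγ)]
        rfl
    simp only [hface, Finset.smul_sum]
    rw [Finset.sum_comm]
    have hsum : ∀ γ ∈ (tupleInter s v).powerset, ∑ i : Fin (n + 2), (-1 : K) ^ (i : ℕ) •
        (moebius ρ γ : Module.End K M) (c (Fin.cons (σ γ) (fun j => v (i.succAbove j)) : Fin (n + 2) → T)) =
        (moebius ρ γ : Module.End K M) (c v) := fun γ hγ => by
      have hγv := subset_tupleInter.1 (Finset.mem_powerset.1 hγ)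
      have hw : γ ⊆ tupleInter s (Fin.cons (σ γ) v : Fin (n + 3) → T) :=
        subset_tupleInter.2 fun i => by
          refine Fin.cases ?_ (fun j => ?_) i
          · exact hσ γ ⟨v 0, hγv 0⟩
          · exact hγv j
      -- The cocycle condition on the cone over `v`: omitting the apex gives `c v`, and the other
      -- faces are cones over faces of `v` with the opposite sign.
      have h := congrArg (moebius ρ γ : Module.End K M) (hδ (Fin.cons (σ γ) v))
      rw [map_zero, map_sum] at h
      simp only [map_smul, ← Module.End.mul_apply, moebius_mul hρ hw] at h
      rw [Fin.sum_univ_succ] at h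
      have h0 : (fun j => (Fin.cons (σ γ) v : Fin (n + 3) → T) (Fin.succAbove 0 j)) = v := by
        funext j; simp
      have h1 : ∀ i : Fin (n + 2),
          (fun j => (Fin.cons (σ γ) v : Fin (n + 3) → T) (i.succ.succAbove j)) =
            (Fin.cons (σ γ) (fun j => v (i.succAbove j)) : Fin (n + 2) → T) := fun i => by
        funext j
        refine Fin.cases ?_ (fun k => ?_) j
        · simp
        · simp
      simp only [h0, h1, Fin.val_zero, pow_zero, one_smul, Fin.val_succ, pow_succ, mul_neg,
        mul_one, neg_smul, Finset.sum_neg_distrib] at h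
      exact (add_neg_eq_zero.1 h).symm
    rw [Finset.sum_congr rfl hsum, ← LinearMap.sum_apply, sum_moebius, hc]

end Tuples

/-! ### Functoriality of Čech cohomology in the coefficients -/

section Functoriality

variable {K : Type u} [Field K] {X : Type u} [TopologicalSpace X]

theorem cechMap_of {F G : (Opens X)ᵒᵖ ⥤ ModuleCat.{u} K} (φ : F ⟶ G) (n : ℕ) (𝒰 : OpenCover X)
    (c : LinearMap.ker (delta F 𝒰 n)) :
    cechMap φ n (Module.DirectLimit.of K _ _ (refine F n) 𝒰 (Submodule.Quotient.mk c)) =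
      Module.DirectLimit.of K _ _ (refine G n) 𝒰 (Submodule.Quotient.mk
        ⟨coeffCochain φ 𝒰 n c.1, cochainMap_mem_ker _ _ _ (delta_coeffCochain φ 𝒰) n c.1 c.2⟩) :=
  Module.DirectLimit.map_apply_of _ _ _

theorem cech_hom_ext {F : (Opens X)ᵒᵖ ⥤ ModuleCat.{u} K} {n : ℕ} {N : Type*} [AddCommMonoid N]
    [Module K N] {f g : CechCohomology F n →ₗ[K] N}
    (h : ∀ (𝒰 : OpenCover X) (c : LinearMap.ker (delta F 𝒰 n)),
      f (Module.DirectLimit.of K _ _ (refine F n) 𝒰 (Submodule.Quotient.mk c)) =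
        g (Module.DirectLimit.of K _ _ (refine F n) 𝒰 (Submodule.Quotient.mk c))) : f = g :=
  Module.DirectLimit.hom_ext fun 𝒰 => LinearMap.ext fun z =>
    Submodule.Quotient.induction_on _ z fun c => h 𝒰 c

theorem cechMap_comp {F G H : (Opens X)ᵒᵖ ⥤ ModuleCat.{u} K} (φ : F ⟶ G) (ψ : G ⟶ H) (n : ℕ) :
    cechMap ψ n ∘ₗ cechMap φ n = cechMap (φ ≫ ψ) n := by
  refine cech_hom_ext fun 𝒰 c => ?_
  rw [LinearMap.comp_apply, cechMap_of, cechMap_of, cechMap_of]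
  rfl

theorem cechMap_id (F : (Opens X)ᵒᵖ ⥤ ModuleCat.{u} K) (n : ℕ) :
    cechMap (𝟙 F) n = LinearMap.id := by
  refine cech_hom_ext fun 𝒰 c => ?_
  rw [cechMap_of]
  rfl

theorem cechMap_add {F G : (Opens X)ᵒᵖ ⥤ ModuleCat.{u} K} (φ ψ : F ⟶ G) (n : ℕ) :
    cechMap (φ + ψ) n = cechMap φ n + cechMap ψ n := by
  refine cech_hom_ext fun 𝒰 c => ?_
  rw [LinearMap.add_apply, cechMap_of, cechMap_of, cechMap_of, ← map_add]
  rfl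

theorem cechMap_zero (F G : (Opens X)ᵒᵖ ⥤ ModuleCat.{u} K) (n : ℕ) :
    cechMap (0 : F ⟶ G) n = 0 := by
  refine cech_hom_ext fun 𝒰 c => ?_
  rw [cechMap_of]
  exact map_zero _

end Functoriality

/-! ### The splitting of the free sheaf -/

section Splitting

variable {P : Type u} [Preorder P] (K : Type u) [Field K]

theorem sumCoord_single {S : Type u} (e : S) (r : K) :
    sumCoord K S (Finsupp.single e r) = r := by
  simp [sumCoord]

/-- The projection of the finitely supported functions onto those with sum zero,
along a basis vector. -/
def kerProj {S : Type u} (e : S) : (S →₀ K) →ₗ[K] LinearMap.ker (sumCoord K S) :=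
  (LinearMap.id - Finsupp.lsingle e ∘ₗ sumCoord K S).codRestrict _ fun w => by
    rw [LinearMap.mem_ker, LinearMap.sub_apply, map_sub, sub_eq_zero]
    exact (sumCoord_single K _ _).symm

/-- The projection `F ⟶ F̄`, `w ↦ w - (∑ w) · x_α`. -/
def restrictedProj (E : P ⥤ Type u) (x : E.sections) :
    freeFunctor K E ⟶ restrictedFunctor K E where
  app α := ModuleCat.ofHom (kerProj K (x.1 α))
  naturality α β f := by
    ext1
    refine LinearMap.ext fun w => Subtype.ext ?_
    have e : E.map f (x.1 α) = x.1 β := x.2 f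
    change E.obj α →₀ K at w
    change Finsupp.lmapDomain K K (E.map f) w -
        Finsupp.single (x.1 β) (sumCoord K _ (Finsupp.lmapDomain K K (E.map f) w)) =
      Finsupp.lmapDomain K K (E.map f) (w - Finsupp.single (x.1 α) (sumCoord K _ w))
    rw [sumCoord_mapDomain, map_sub, Finsupp.lmapDomain_apply, Finsupp.lmapDomain_apply,
      Finsupp.mapDomain_single, e]

variable {K} in
theorem toSheafMap_comp {F G H : P ⥤ ModuleCat.{u} K} (φ : F ⟶ G) (ψ : G ⟶ H) :
    toSheafMap φ ≫ toSheafMap ψ = toSheafMap (φ ≫ ψ) := rfl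

variable {K} in
theorem toSheafMap_id (F : P ⥤ ModuleCat.{u} K) : toSheafMap (𝟙 F) = 𝟙 _ := rfl

variable {K} in
theorem toSheafMap_add {F G : P ⥤ ModuleCat.{u} K} (φ ψ : F ⟶ G) :
    toSheafMap (φ + ψ) = toSheafMap φ + toSheafMap ψ := rfl

variable {K} in
theorem toSheafMap_zero (F G : P ⥤ ModuleCat.{u} K) : toSheafMap (0 : F ⟶ G) = 0 := rfl

variable (E : P ⥤ Type u) (x : E.sections)

theorem inclusion_augmentation : inclusion K E ≫ augmentation K E = 0 := by
  ext α : 3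
  exact LinearMap.ext fun w => w.2

theorem constEmbedding_augmentation :
    constEmbedding K E x ≫ augmentation K E = 𝟙 _ := by
  ext α : 3
  refine LinearMap.ext fun r => ?_
  exact sumCoord_single K (x.1 α) r

theorem inclusion_restrictedProj : inclusion K E ≫ restrictedProj K E x = 𝟙 _ := by
  ext α : 3
  refine LinearMap.ext fun w => Subtype.ext ?_
  change w.1 - Finsupp.single (x.1 α) (sumCoord K _ w.1) = w.1
  rw [LinearMap.mem_ker.1 w.2, Finsupp.single_zero, sub_zero]

theorem constEmbedding_restrictedProj : constEmbedding K E x ≫ restrictedProj K E x = 0 := by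
  ext α : 3
  refine LinearMap.ext fun r => Subtype.ext ?_
  change K at r
  change Finsupp.single (x.1 α) r -
    Finsupp.single (x.1 α) (sumCoord K _ (Finsupp.single (x.1 α) r)) = 0
  rw [sumCoord_single, sub_self]

theorem restrictedProj_add_augmentation :
    restrictedProj K E x ≫ inclusion K E + augmentation K E ≫ constEmbedding K E x = 𝟙 _ := by
  ext α : 3
  refine LinearMap.ext fun w => ?_
  exact sub_add_cancel (G := E.obj α →₀ K) w (Finsupp.single (x.1 α) (sumCoord K _ w))

theorem augmentation_decomposition (n : ℕ) :
    cechMap (toSheafMap (augmentation K E)) n ∘ₗ decomposition K E x n =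
      LinearMap.snd K (HRestricted K E n) (HConst K P n) := by
  rw [decomposition, LinearMap.comp_coprod, cechMap_comp, cechMap_comp, toSheafMap_comp,
    toSheafMap_comp, inclusion_augmentation, constEmbedding_augmentation, toSheafMap_zero,
    toSheafMap_id, cechMap_zero, cechMap_id]
  ext <;> simp

theorem restrictedProj_decomposition (n : ℕ) :
    cechMap (toSheafMap (restrictedProj K E x)) n ∘ₗ decomposition K E x n =
      LinearMap.fst K (HRestricted K E n) (HConst K P n) := by
  rw [decomposition, LinearMap.comp_coprod, cechMap_comp, cechMap_comp, toSheafMap_comp,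
    toSheafMap_comp, inclusion_restrictedProj, constEmbedding_restrictedProj, toSheafMap_zero,
    toSheafMap_id, cechMap_zero, cechMap_id]
  ext <;> simp

/-- The inverse has components induced by `restrictedProj` and `augmentation`; the biproduct
identities are transported from the copresheaves. -/
theorem decomposition_bijective (n : ℕ) : Function.Bijective (decomposition K E x n) := by
  refine Function.bijective_iff_has_inverse.2
    ⟨(cechMap (toSheafMap (restrictedProj K E x)) n).prod
      (cechMap (toSheafMap (augmentation K E)) n), fun p => ?_, fun z => ?_⟩
  · exact Prod.ext (LinearMap.congr_fun (restrictedProj_decomposition K E x n) p)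
      (LinearMap.congr_fun (augmentation_decomposition K E x n) p)
  · have h := congrArg (fun φ => cechMap (toSheafMap φ) n) (restrictedProj_add_augmentation K E x)
    simp only [toSheafMap_add, ← toSheafMap_comp, toSheafMap_id, cechMap_add, ← cechMap_comp,
      cechMap_id] at h
    exact LinearMap.congr_fun h z

/-- Both squares commute already for copresheaves; only the one for the constants needs `φ` to carry
`x` to `x'`. -/
theorem freeMap_decomposition {E E' : P ⥤ Type u} (φ : E ⟶ E') (x : E.sections)
    (x' : E'.sections) (h : ∀ α, φ.app α (x.1 α) = x'.1 α) (n : ℕ) :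
    cechMap (toSheafMap (freeMap K φ)) n ∘ₗ decomposition K E x n =
      decomposition K E' x' n ∘ₗ
        (cechMap (toSheafMap (restrictedMap K φ)) n).prodMap LinearMap.id := by
  have h₁ : inclusion K E ≫ freeMap K φ = restrictedMap K φ ≫ inclusion K E' := rfl
  have h₂ : constEmbedding K E x ≫ freeMap K φ = constEmbedding K E' x' := by
    ext α : 3
    refine LinearMap.ext fun r => ?_
    change Finsupp.mapDomain (φ.app α) (Finsupp.single (x.1 α) r) = Finsupp.single (x'.1 α) r
    rw [Finsupp.mapDomain_single, h]
  have h₃ := congrArg (fun ψ => cechMap (toSheafMap ψ) n) h₁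
  have h₄ := congrArg (fun ψ => cechMap (toSheafMap ψ) n) h₂
  simp only [← toSheafMap_comp, ← cechMap_comp] at h₃ h₄
  rw [decomposition, decomposition, LinearMap.comp_coprod, h₃, h₄]
  ext <;> simp

end Splitting

/-! ### The finest covering of an Alexandrov space -/

section Finest

variable {P : Type u} [Preorder P]

/-- The smallest open neighbourhood `U_α` of `α`. -/
def basicOpen (α : P) : Opens (Topology.WithUpperSet P) where
  carrier := {β | α ≤ Topology.WithUpperSet.ofUpperSet β}
  is_open' := Topology.IsUpperSet.isOpen_iff_isUpperSet.2 fun _ _ h h' => le_trans h' h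

theorem mem_basicOpen {α : P} {β : Topology.WithUpperSet P} :
    β ∈ basicOpen α ↔ α ≤ Topology.WithUpperSet.ofUpperSet β := Iff.rfl

theorem basicOpen_le {α : P} {U : Opens (Topology.WithUpperSet P)}
    (h : Topology.WithUpperSet.toUpperSet α ∈ U) : basicOpen α ≤ U := fun _ hβ =>
  Topology.IsUpperSet.isOpen_iff_isUpperSet.1 U.2 (by exact hβ) h

variable (P) in
/-- The covering by all the sets `U_α`. -/
def finestCover : OpenCover (Topology.WithUpperSet P) where
  sets := Set.range basicOpen
  covers x := ⟨basicOpen (Topology.WithUpperSet.ofUpperSet x), ⟨_, rfl⟩, le_refl _⟩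

theorem le_finestCover (𝒰 : OpenCover (Topology.WithUpperSet P)) : 𝒰 ≤ finestCover P := by
  rintro _ ⟨α, rfl⟩
  obtain ⟨U, hU, h⟩ := 𝒰.covers (Topology.WithUpperSet.toUpperSet α)
  exact ⟨U, hU, basicOpen_le h⟩

theorem cechCohomology_subsingleton {K : Type u} [Field K]
    {F : (Opens (Topology.WithUpperSet P))ᵒᵖ ⥤ ModuleCat.{u} K} {n : ℕ}
    (h : ∀ c : Cochain F (finestCover P) (n + 1), delta F _ (n + 1) c = 0 →
      ∃ b, delta F (finestCover P) n b = c) :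
    Subsingleton (CechCohomology F (n + 1)) := by
  have hc : Subsingleton (CoverCohomology F (n + 1) (finestCover P)) := by
    refine subsingleton_of_forall_eq 0 fun z => ?_
    refine Submodule.Quotient.induction_on _ z fun c => ?_
    exact (Submodule.Quotient.mk_eq_zero _).2 (h c.1 c.2)
  have hid : (LinearMap.id : CechCohomology F (n + 1) →ₗ[K] _) = 0 := by
    refine Module.DirectLimit.hom_ext fun 𝒰 => LinearMap.ext fun z => ?_
    -- Each class equals its image from the finest covering, where the cohomology is zero.
    have e := Module.DirectLimit.of_f (R := K) (f := refine F (n + 1))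
      (hij := le_finestCover 𝒰) (x := z)
    rw [Subsingleton.elim (refine F (n + 1) 𝒰 _ (le_finestCover 𝒰) z) 0, map_zero] at e
    exact e.symm
  exact subsingleton_of_forall_eq 0 fun z => LinearMap.congr_fun hid z

end Finest

/-! ### Functors of product type -/

section Product

variable {I : Type u} {A : Set (Finset I)} {E : HPoset A ⥤ Type u} {B : I → Type u}

section Restrict

variable (e : ∀ α : HPoset A, E.obj α ≃ (∀ i : {i : I // i ∈ verts α}, B i.1))

/-- The point of `E_α` with given coordinates. -/
def restrictPoint (α : HPoset A) (y : ∀ i, B i) : E.obj α := (e α).symm fun i => y i.1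

theorem map_restrictPoint {α β : HPoset A}
    (he : ∀ (α β : HPoset A) (f : α ⟶ β) (x : E.obj α) (i : {i : I // i ∈ verts β}),
      e β (E.map f x) i = e α x ⟨i.1, verts_subset f i.2⟩) (f : α ⟶ β) (y : ∀ i, B i) :
    E.map f (restrictPoint e α y) = restrictPoint e β y := by
  refine (e β).injective (funext fun i => ?_)
  rw [he, restrictPoint, restrictPoint, Equiv.apply_symm_apply, Equiv.apply_symm_apply]

end Restrict

variable [DecidableEq I] (b : ∀ i, B i)

/-- Replace the coordinates outside `δ` by those of the base point. -/
def truncate (δ : Finset I) (y : ∀ i, B i) (i : I) : B i := if i ∈ δ then y i else b i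

theorem truncate_truncate (α β : Finset I) (y : ∀ i, B i) :
    truncate b α (truncate b β y) = truncate b (α ∩ β) y := by
  funext i
  simp only [truncate, Finset.mem_inter]
  split_ifs <;> tauto

/-- Truncation of finitely supported functions. -/
def truncateEnd (K : Type u) [Field K] (δ : Finset I) : Module.End K ((∀ i, B i) →₀ K) :=
  Finsupp.lmapDomain K K (truncate b δ)

theorem truncateEnd_mul (K : Type u) [Field K] (α β : Finset I) :
    truncateEnd b K α * truncateEnd b K β = truncateEnd b K (α ∩ β) := by
  rw [Module.End.mul_eq_comp, truncateEnd, truncateEnd, ← Finsupp.lmapDomain_comp]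
  exact congrArg _ (funext fun y => truncate_truncate b α β y)

/-- Truncating all coordinates leaves only the base point. Hence being killed by this operator is
the same as having sum zero. -/
theorem truncateEnd_empty {K : Type u} [Field K] (m : (∀ i, B i) →₀ K) :
    truncateEnd b K ∅ m = Finsupp.single b (sumCoord K _ m) := by
  induction m using Finsupp.induction_linear with
  | zero => simp
  | add f g hf hg => rw [map_add, map_add, hf, hg, Finsupp.single_add]
  | single y r =>
    have : truncate b ∅ y = b := by funext i; simp [truncate]
    rw [sumCoord_single, truncateEnd, Finsupp.lmapDomain_apply, Finsupp.mapDomain_single, this]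

variable (e : ∀ α : HPoset A, E.obj α ≃ (∀ i : {i : I // i ∈ verts α}, B i.1))

/-- Extend a point of `E_α` by the base point. -/
def extendPoint (α : HPoset A) (x : E.obj α) (i : I) : B i :=
  if h : i ∈ verts α then e α x ⟨i, h⟩ else b i

theorem restrictPoint_extendPoint {α β : HPoset A}
    (he : ∀ (α β : HPoset A) (f : α ⟶ β) (x : E.obj α) (i : {i : I // i ∈ verts β}),
      e β (E.map f x) i = e α x ⟨i.1, verts_subset f i.2⟩) (f : α ⟶ β) (x : E.obj α) :
    restrictPoint e β (extendPoint b e α x) = E.map f x := by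
  refine (e β).symm_apply_eq.2 (funext fun i => ?_)
  rw [he, extendPoint, dif_pos (verts_subset f i.2)]

theorem restrictPoint_truncate {α : HPoset A} {δ : Finset I} (h : verts α ⊆ δ) (y : ∀ i, B i) :
    restrictPoint e α (truncate b δ y) = restrictPoint e α y :=
  congrArg (e α).symm (funext fun i => if_pos (h i.2))

/-- Under extension by the base point the transition maps of `E` become truncations. -/
theorem truncate_extendPoint {α β : HPoset A}
    (he : ∀ (α β : HPoset A) (f : α ⟶ β) (x : E.obj α) (i : {i : I // i ∈ verts β}),
      e β (E.map f x) i = e α x ⟨i.1, verts_subset f i.2⟩) (f : α ⟶ β) (x : E.obj α) :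
    truncate b (verts β) (extendPoint b e α x) = extendPoint b e β (E.map f x) := by
  funext i
  by_cases h : i ∈ verts β
  · rw [truncate, if_pos h, extendPoint, extendPoint, dif_pos h, dif_pos (verts_subset f h), he]
  · rw [truncate, if_neg h, extendPoint, dif_neg h]

end Product

/-! ### Vanishing for the restricted free sheaf -/

section Vanishing

variable {I : Type u} {A : Set (Finset I)} {K : Type u} [Field K]
  {E : HPoset A ⥤ Type u}

/-- The edge of the hypergraph that defines a member of the finest covering. -/
def coverEdge (V : ↥(finestCover (HPoset A)).sets) : Finset I := verts V.2.choose

theorem coverEdge_mem (V : ↥(finestCover (HPoset A)).sets) : coverEdge V ∈ A :=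
  (OrderDual.ofDual V.2.choose).2

theorem mem_iff_subset_coverEdge (V : ↥(finestCover (HPoset A)).sets) (β : HPoset A) :
    Topology.WithUpperSet.toUpperSet β ∈ V.1 ↔ verts β ⊆ coverEdge V := by
  conv_lhs => rw [← V.2.choose_spec]
  exact Iff.rfl

/-- The value of a section of the restricted free sheaf at a point of its domain. -/
def sectionAt {U : Opens (Topology.WithUpperSet (HPoset A))} (β : HPoset A)
    (hβ : Topology.WithUpperSet.toUpperSet β ∈ U) :
    (toSheaf (restrictedFunctor K E)).obj (op U) →ₗ[K] (E.obj β →₀ K) :=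
  (LinearMap.ker (sumCoord K (E.obj β))).subtype ∘ₗ
    LinearMap.proj (φ := fun α : {α : HPoset A // Topology.WithUpperSet.toUpperSet α ∈ U} =>
      (restrictedFunctor K E).obj α.1) ⟨β, hβ⟩ ∘ₗ
    (sectionsOver (restrictedFunctor K E) U).subtype

theorem section_ext {U : Opens (Topology.WithUpperSet (HPoset A))}
    {s t : (toSheaf (restrictedFunctor K E)).obj (op U)}
    (h : ∀ β hβ, sectionAt β hβ s = sectionAt β hβ t) : s = t :=
  Subtype.ext (funext fun β => Subtype.ext (h β.1 β.2))

theorem sectionAt_res {U V : Opens (Topology.WithUpperSet (HPoset A))} (h : U ≤ V) (β : HPoset A)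
    (hβ : Topology.WithUpperSet.toUpperSet β ∈ U)
    (s : (toSheaf (restrictedFunctor K E)).obj (op V)) :
    sectionAt β hβ (res _ h s) = sectionAt β (h hβ) s := rfl

theorem sumCoord_sectionAt {U : Opens (Topology.WithUpperSet (HPoset A))} (β : HPoset A)
    (hβ : Topology.WithUpperSet.toUpperSet β ∈ U)
    (s : (toSheaf (restrictedFunctor K E)).obj (op U)) :
    sumCoord K _ (sectionAt β hβ s) = 0 :=
  (s.1 ⟨β, hβ⟩).2

theorem map_sectionAt {U : Opens (Topology.WithUpperSet (HPoset A))} {α β : HPoset A}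
    (f : α ⟶ β) (hα : Topology.WithUpperSet.toUpperSet α ∈ U)
    (hβ : Topology.WithUpperSet.toUpperSet β ∈ U)
    (s : (toSheaf (restrictedFunctor K E)).obj (op U)) :
    Finsupp.lmapDomain K K (E.map f) (sectionAt α hα s) = sectionAt β hβ s :=
  congrArg Subtype.val (s.2 ⟨α, hα⟩ ⟨β, hβ⟩ f)

theorem sectionAt_delta {𝒰 : OpenCover (Topology.WithUpperSet (HPoset A))} {n : ℕ}
    (c : Cochain (toSheaf (restrictedFunctor K E)) 𝒰 n) (v : Nerve 𝒰 (n + 1)) (β : HPoset A)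
    (hβ : Topology.WithUpperSet.toUpperSet β ∈ v.inter) :
    sectionAt β hβ (delta _ 𝒰 n c v) = ∑ i : Fin (n + 2), (-1 : K) ^ (i : ℕ) •
      sectionAt β (v.inter_le_face i hβ) (c (v.face i)) := by
  rw [delta_apply, map_sum]
  exact Finset.sum_congr rfl fun i _ => by rw [map_smul, sectionAt_res]

variable {B : I → Type u}

/-- The section of the restricted free sheaf given by a finitely supported function with sum zero
on the full product. -/
def globalSection (e : ∀ α : HPoset A, E.obj α ≃ (∀ i : {i : I // i ∈ verts α}, B i.1))
    (he : ∀ (α β : HPoset A) (f : α ⟶ β) (x : E.obj α) (i : {i : I // i ∈ verts β}),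
      e β (E.map f x) i = e α x ⟨i.1, verts_subset f i.2⟩)
    (m : (∀ i, B i) →₀ K) (hm : sumCoord K _ m = 0)
    (U : Opens (Topology.WithUpperSet (HPoset A))) :
    (toSheaf (restrictedFunctor K E)).obj (op U) :=
  (⟨fun β => (⟨Finsupp.lmapDomain K K (restrictPoint e β.1) m,
      (sumCoord_mapDomain K _ m).trans hm⟩ : LinearMap.ker (sumCoord K (E.obj β.1))),
    fun α β f => Subtype.ext (by
      change Finsupp.lmapDomain K K (E.map f) (Finsupp.lmapDomain K K (restrictPoint e α.1) m) =
        Finsupp.lmapDomain K K (restrictPoint e β.1) m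
      rw [← LinearMap.comp_apply, ← Finsupp.lmapDomain_comp]
      exact congrArg (fun g => Finsupp.lmapDomain K K g m)
        (funext fun y => map_restrictPoint e he f y))⟩ :
    sectionsOver (restrictedFunctor K E) U)

variable [DecidableEq I]

theorem mem_inter_iff {n : ℕ} (v : Nerve (finestCover (HPoset A)) n) (β : HPoset A) :
    Topology.WithUpperSet.toUpperSet β ∈ v.inter ↔ verts β ⊆ tupleInter coverEdge v.1 := by
  rw [subset_tupleInter]
  refine ⟨fun h i => (mem_iff_subset_coverEdge (v.1 i) β).1 (iInf_le (fun i => (v.1 i).1) i h),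
    fun h => ?_⟩
  have hle : basicOpen β ≤ v.inter :=
    le_iInf fun i => basicOpen_le ((mem_iff_subset_coverEdge (v.1 i) β).2 (h i))
  exact hle (mem_basicOpen.2 le_rfl)

theorem tupleInter_mem_of_nerve (hA : WeakIntersection A) {n : ℕ}
    {v : Fin (n + 1) → ↥(finestCover (HPoset A)).sets}
    (hv : ∃ x : Topology.WithUpperSet (HPoset A), ∀ i, x ∈ (v i : Opens _)) :
    tupleInter coverEdge v ∈ A := by
  by_cases h : (tupleInter coverEdge v).Nonempty
  · exact tupleInter_mem hA coverEdge_mem v h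
  -- Weak intersection says nothing about an empty intersection, but a common point must then be the
  -- edge `∅` itself.
  · obtain ⟨x, hx⟩ := hv
    have hsub : verts (Topology.WithUpperSet.ofUpperSet x) ⊆ tupleInter coverEdge v :=
      subset_tupleInter.2 fun i => (mem_iff_subset_coverEdge (v i) _).1 (hx i)
    rw [Finset.not_nonempty_iff_eq_empty] at h
    rw [h, Finset.subset_empty] at hsub
    rw [h, ← hsub]
    exact (OrderDual.ofDual (Topology.WithUpperSet.ofUpperSet x)).2

/-- A non-empty intersection would be an edge, hence a common point of the open sets. -/
theorem tupleInter_eq_empty (hA : WeakIntersection A) {n : ℕ}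
    {v : Fin (n + 1) → ↥(finestCover (HPoset A)).sets}
    (hv : ¬ ∃ x : Topology.WithUpperSet (HPoset A), ∀ i, x ∈ (v i : Opens _)) :
    tupleInter coverEdge v = ∅ := by
  by_contra h
  have hmem := tupleInter_mem hA coverEdge_mem v (Finset.nonempty_iff_ne_empty.2 h)
  refine hv ⟨Topology.WithUpperSet.toUpperSet (OrderDual.toDual ⟨_, hmem⟩), fun i => ?_⟩
  exact (mem_iff_subset_coverEdge (v i) _).2 (subset_tupleInter.1 subset_rfl i)

theorem exists_delta_eq (hA : WeakIntersection A) (b : ∀ i, B i)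
    (e : ∀ α : HPoset A, E.obj α ≃ (∀ i : {i : I // i ∈ verts α}, B i.1))
    (he : ∀ (α β : HPoset A) (f : α ⟶ β) (x : E.obj α) (i : {i : I // i ∈ verts β}),
      e β (E.map f x) i = e α x ⟨i.1, verts_subset f i.2⟩) {n : ℕ}
    (c : Cochain (toSheaf (restrictedFunctor K E)) (finestCover (HPoset A)) (n + 1))
    (hc : delta _ _ (n + 1) c = 0) : ∃ a, delta _ _ n a = c := by
  classical
  -- The intersection of the edges is itself a point of the simplex's open set, with an arrow to
  -- every other point there.
  have hedge : ∀ {k : ℕ} (v : Nerve (finestCover (HPoset A)) k),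
      Topology.WithUpperSet.toUpperSet (OrderDual.toDual (⟨_, tupleInter_mem_of_nerve hA v.2⟩ : A))
        ∈ v.inter := fun v => (mem_inter_iff v _).2 subset_rfl
  let ext (β : HPoset A) : (E.obj β →₀ K) →ₗ[K] ((∀ i, B i) →₀ K) :=
    Finsupp.lmapDomain K K (extendPoint b e β)
  have hext : ∀ {α β : HPoset A} (f : α ⟶ β) (w : E.obj α →₀ K),
      truncateEnd b K (verts β) (ext α w) = ext β (Finsupp.lmapDomain K K (E.map f) w) := by
    intro α β f w
    rw [← LinearMap.comp_apply, ← LinearMap.comp_apply, truncateEnd, ← Finsupp.lmapDomain_comp,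
      ← Finsupp.lmapDomain_comp]
    exact congrArg (fun g => Finsupp.lmapDomain K K g w)
      (funext fun x => truncate_extendPoint b e he f x)
  -- Zero off the nerve is forced: there the intersection is `∅`, and the value must be both fixed
  -- and killed by `truncateEnd b K ∅`.
  let c' (v : Fin (n + 2) → ↥(finestCover (HPoset A)).sets) : (∀ i, B i) →₀ K :=
    if hv : ∃ x : Topology.WithUpperSet (HPoset A), ∀ i, x ∈ (v i : Opens _) then
      ext _ (sectionAt _ (hedge ⟨v, hv⟩) (c ⟨v, hv⟩)) else 0
  have hc' : ∀ v : Nerve (finestCover (HPoset A)) (n + 1),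
      c' v.1 = ext _ (sectionAt _ (hedge v) (c v)) := fun v => dif_pos v.2
  have htrunc : ∀ (v : Nerve (finestCover (HPoset A)) (n + 1)) (β : HPoset A)
      (hβ : Topology.WithUpperSet.toUpperSet β ∈ v.inter),
      truncateEnd b K (verts β) (c' v.1) = ext β (sectionAt β hβ (c v)) := fun v β hβ => by
    rw [hc', hext (homOfLE ((mem_inter_iff v β).1 hβ)), map_sectionAt _ _ hβ]
  have hzero : ∀ v, truncateEnd b K ∅ (c' v) = 0 := fun v => by
    by_cases hv : ∃ x : Topology.WithUpperSet (HPoset A), ∀ i, x ∈ (v i : Opens _)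
    · rw [hc' ⟨v, hv⟩, truncateEnd_empty, sumCoord_mapDomain, sumCoord_sectionAt,
        Finsupp.single_zero]
    · rw [show c' v = 0 from dif_neg hv, map_zero]
  obtain ⟨a, ha₀, ha⟩ := exists_tuple_primitive (truncateEnd_mul b K) coverEdge c'
    (fun v => by
      by_cases hv : ∃ x : Topology.WithUpperSet (HPoset A), ∀ i, x ∈ (v i : Opens _)
      · exact (htrunc ⟨v, hv⟩ _ (hedge ⟨v, hv⟩)).trans (hc' ⟨v, hv⟩).symm
      · rw [show c' v = 0 from dif_neg hv, map_zero])
    hzero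
    (fun w => by
      by_cases hw : ∃ x : Topology.WithUpperSet (HPoset A), ∀ i, x ∈ (w i : Opens _)
      · let w' : Nerve (finestCover (HPoset A)) (n + 2) := ⟨w, hw⟩
        have h := congrArg (fun d => ext _ (sectionAt _ (hedge w') (d w'))) hc
        simp only [sectionAt_delta, map_sum, map_smul] at h
        refine (Finset.sum_congr rfl fun i _ => ?_).trans (h.trans ?_)
        · exact congrArg _ (htrunc (w'.face i) _ (w'.inter_le_face i (hedge w')))
        · rw [Pi.zero_apply, map_zero, map_zero]
      -- Off the nerve every term is truncated to `∅`, hence vanishes even if some faces lie in the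
      -- nerve.
      · rw [tupleInter_eq_empty hA hw]
        exact Finset.sum_eq_zero fun i _ => by rw [hzero, smul_zero])
  have ha₁ : ∀ u, sumCoord K _ (a u) = 0 := fun u => by
    have h := ha₀ u
    rwa [truncateEnd_empty, Finsupp.single_eq_zero] at h
  refine ⟨fun u => globalSection e he (a u.1) (ha₁ u.1) u.inter, funext fun v => ?_⟩
  refine section_ext fun β hβ => ?_
  rw [sectionAt_delta]
  have hβ' := (mem_inter_iff v β).1 hβ
  -- Restriction to `β` does not see coordinates outside the intersection, so the truncations in the
  -- tuple differential disappear and the Čech differential remains.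
  have hres : ∀ m : (∀ i, B i) →₀ K, Finsupp.lmapDomain K K (restrictPoint e β)
      (truncateEnd b K (tupleInter coverEdge v.1) m) =
        Finsupp.lmapDomain K K (restrictPoint e β) m := fun m => by
    rw [← LinearMap.comp_apply, truncateEnd, ← Finsupp.lmapDomain_comp]
    exact congrArg (fun g => Finsupp.lmapDomain K K g m)
      (funext fun y => restrictPoint_truncate b e hβ' y)
  have h := congrArg (Finsupp.lmapDomain K K (restrictPoint e β)) (ha v.1)
  simp only [map_sum, map_smul, hres] at h
  refine h.trans ?_
  rw [hc', ← LinearMap.comp_apply, ← Finsupp.lmapDomain_comp,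
    ← map_sectionAt (homOfLE hβ') (hedge v) hβ]
  exact congrArg (fun g => Finsupp.lmapDomain K K g _)
    (funext fun x => restrictPoint_extendPoint b e he (homOfLE hβ') x)

end Vanishing

end CechHypergraph

end

open CechHypergraph in
theorem theorem5 {K : Type u} [Field K] {I : Type u} [DecidableEq I] (A : Set (Finset I))
    (hA : WeakIntersection A) (hfin : UpperFinitelyCovered (HPoset A))
    (E : HPoset A ⥤ Type u) (hE : IsProductFunctor E) :
    -- the cohomology of the restricted free sheaf is concentrated in degree zero
    (∀ n : ℕ, 1 ≤ n → Subsingleton (HRestricted K E n)) ∧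
    -- `E` has coherent families of points, and each of them gives a direct sum decomposition
    -- whose projection to the constant part is the sum of coordinates
    Nonempty E.sections ∧
    (∀ (x : E.sections) (n : ℕ),
      Function.Bijective (decomposition K E x n) ∧
      cechMap (toSheafMap (augmentation K E)) n ∘ₗ decomposition K E x n =
        LinearMap.snd K (HRestricted K E n) (HConst K (HPoset A) n)) ∧
    -- the decomposition is natural in `E`
    (∀ (E' : HPoset A ⥤ Type u), IsProductFunctor E' → ∀ (φ : E ⟶ E')
      (x : E.sections) (x' : E'.sections), (∀ α : HPoset A, φ.app α (x.1 α) = x'.1 α) →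
      ∀ n : ℕ,
        cechMap (toSheafMap (freeMap K φ)) n ∘ₗ decomposition K E x n =
          decomposition K E' x' n ∘ₗ
            (cechMap (toSheafMap (restrictedMap K φ)) n).prodMap LinearMap.id) := by
  obtain ⟨B, hB, e, he⟩ := hE
  let b : ∀ i, B i := fun i => (hB i).some
  refine ⟨fun n hn => ?_, ⟨fun α => restrictPoint e α b, fun f => map_restrictPoint e he f b⟩,
    fun x n => ⟨decomposition_bijective K E x n, augmentation_decomposition K E x n⟩,
    fun E' _ φ x x' h n => freeMap_decomposition K φ x x' h n⟩
  obtain ⟨n, rfl⟩ := Nat.exists_eq_add_of_le' hn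
  exact cechCohomology_subsingleton fun c hc => exists_delta_eq hA b e he c hc
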